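/- **Setting.** Let $X$ be a finite cell complex, given by finite sets $X_n$ of $n$-cells ($n\ge 0$, empty for large $n$), with chain groups $C_n=\mathbb{Z}^{X_n}$ and integer boundary matrices $\partial_n:C_n\to C_{n-1}$ with $\partial_{n}\partial_{n+1}=0$. It is augmented by $C_{-1}=\mathbb{Z}$ and $\partial_0=(1,\dots,1)$, with $\partial_0\partial_1=0$. Put $Z_n=\ker\partial_n$, $\delta_n=\partial_{n+1}^t:C_n\to C_{n+1}$, $Z^n=\ker\delta_n$, $B^n=\operatorname{im}\delta_{n-1}$, and let $\widetilde H_n$, $\widetilde H^n$ be the reduced integral (co)homology groups. Fix $i\ge 0$ and assume the unicycle condition $\operatorname{rk}\widetilde H_{i+1}(X)=0$, $\operatorname{rk}\widetilde H_i(X)=1$, $\operatorname{rk}\widetilde H_{i-1}(X)=0$. Let $\mathcal S_i$ be the set of subcomplexes $Y$ with $X^{i-1}\subseteq Y\subseteq X^i$ (where $X^n$ is the $n$-skeleton), and let $I(Y)$ be the set of $i$-cells of $Y$. The complement $\overline Y\in\mathcal S_i$ has $I(\overline Y)=X_i\setminus I(Y)$. * $\mathcal T_i$ is the set of $i$-dimensional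 spanning trees, those of weight zero included: the $T\in\mathcal S_i$ with $|I(T)|=\operatorname{rk}Z_{i-1}(X)$. Its weight is $\mathrm{wt}(T)=|\widetilde H_{i-1}(T)|$ if this is finite, and $0$ otherwise. * $\mathcal U^i$ is the set of $i$-dimensional dual cycletrees: the $U^*\in\mathcal S_i$ with $|I(U^*)|=\operatorname{rk}Z^{i+1}(X)+1$. Its weight is $\mathrm{wt}(U^*)=|H^{i+1}(X,\overline{U^*})|$ if this is finite, and $0$ otherwise. * For $U^*\in\mathcal U^i$, let $m=\operatorname{rk}Z^{i+1}(X)$, choose a $\mathbb Z$-basis of $Z^{i+1}(X)$ and an enumeration of $I(U^*)$, and let $A$ be the $m\times(m+1)$ matrix whose columns are the coboundaries of the $i$-cells of $U^*$ in that basis. The cocycle part $C_{U^*}\in Z^i(X)$ has the coefficient $(-1)^j\det([A]_j)$ at the $j$-th cell of $U^*$, where $[A]_j$ is $A$ without its $j$-th column, and $0$ at the other $i$-cells. Let $\widehat{C_{U^*}}$ be $C_{U^*}$ divided by the gcd of its coefficients (and $0$ if $C_{U^*}=0$). * The cutting number $c:Z^i(X)\to\mathbb Z$ is $c(z)=\det([z]_Z,[\overline\delta_{i-1}]_Z)$,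 where $Z$ is a $\mathbb Z$-basis of $Z^i(X)$, the columns of $\overline\delta_{i-1}$ form a $\mathbb Z$-basis of the lattice $B^i(X)$, and $[\,\cdot\,]_Z$ denotes coordinates with respect to $Z$. **Theorem.** The complement operator restricts to a bijection between $\mathcal U^i$ and $\mathcal T_i$. For $U^*\in\mathcal U^i$ and $T\in\mathcal T_i$ with $U^*=\overline T$, and for all choices of the bases and the enumeration above, $$|c(C_{U^*})|=\mathrm{wt}(U^*)\,|c(\widehat{C_{U^*}})|=\mathrm{wt}(T)\,|\widetilde H^{i+1}(X)|.$$ Moreover, $c(C_{U^*})=0$ if and only if $\mathrm{wt}(T)=0$. -/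

import Mathlib

universe u

/-- A finite complex: finite sets of cells in each dimension `n ≥ 0`, empty in all large dimensions,
with integer boundary matrices `bdry n = ∂_{n+1} : C_{n+1} → C_n` satisfying `∂ ∘ ∂ = 0`, including
`∂_0 ∘ ∂_1 = 0` for the augmentation `∂_0 = (1, …, 1)`. -/
structure FiniteComplex where
  cell : ℕ → Type u
  fintypeCell : ∀ n, Fintype (cell n)
  decEqCell : ∀ n, DecidableEq (cell n)
  bounded : ∃ d, ∀ n, d < n → IsEmpty (cell n)
  bdry : ∀ n, Matrix (cell n) (cell (n + 1)) ℤ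
  bdry_mul_bdry : ∀ n, bdry n * bdry (n + 1) = 0
  augmented : ∀ e : cell 1, ∑ v, bdry 0 v e = 0

attribute [instance] FiniteComplex.fintypeCell FiniteComplex.decEqCell

/-- The homology `ker A / im B` at the middle term of `ℤ^n --B--> ℤ^m --A--> ℤ^l`. -/
abbrev matrixHomology {l m n : Type*} [Fintype m] [Fintype n]
    (A : Matrix l m ℤ) (B : Matrix m n ℤ) : Type _ :=
  LinearMap.ker A.mulVecLin ⧸ (LinearMap.range B.mulVecLin).submoduleOf (LinearMap.ker A.mulVecLin)

namespace FiniteComplex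

/-! ### The augmented chain complex -/

/-- The generators of the augmented chain complex, with the degree shifted by two: `X.gen n` is the
basis of `C_{n-2}`, so that `C_{-2} = 0`, `C_{-1} = ℤ`, and `C_n` has basis `X.cell n`. -/
abbrev gen (X : FiniteComplex.{u}) : ℕ → Type u
  | 0 => PEmpty
  | 1 => PUnit
  | n + 2 => X.cell n

instance (X : FiniteComplex.{u}) : ∀ n, Fintype (X.gen n)
  | 0 => inferInstanceAs (Fintype PEmpty)
  | 1 => inferInstanceAs (Fintype PUnit)
  | n + 2 => X.fintypeCell n

/-- The boundary matrices of the augmented complex: `X.d n = ∂_{n-1} : C_{n-1} → C_{n-2}`. -/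
def d (X : FiniteComplex.{u}) : ∀ n, Matrix (X.gen n) (X.gen (n + 1)) ℤ
  | 0 => 0
  | 1 => fun _ _ => 1
  | n + 2 => X.bdry n

theorem d_mul_d (X : FiniteComplex.{u}) : ∀ n, X.d n * X.d (n + 1) = 0
  | 0 => by ext a; exact a.elim
  | 1 => by
      ext _ e
      refine (Matrix.mul_apply ..).trans (Eq.trans ?_ (X.augmented e))
      exact Finset.sum_congr rfl fun v _ => one_mul (X.bdry 0 v e)
  | n + 2 => X.bdry_mul_bdry n

/-- `X.cycles n = Z_{n-1} = ker ∂_{n-1}`, a subgroup of `C_{n-1}`. -/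
abbrev cycles (X : FiniteComplex.{u}) (n : ℕ) : Submodule ℤ (X.gen (n + 1) → ℤ) :=
  LinearMap.ker (X.d n).mulVecLin

/-- `X.cocycles n = Z^{n-1} = ker ∂_nᵗ`, a subgroup of `C_{n-1}`. -/
abbrev cocycles (X : FiniteComplex.{u}) (n : ℕ) : Submodule ℤ (X.gen (n + 1) → ℤ) :=
  LinearMap.ker (X.d (n + 1)).transpose.mulVecLin

/-- `X.coboundaries n = B^{n-1} = im ∂_{n-1}ᵗ`, a subgroup of `C_{n-1}`. -/
abbrev coboundaries (X : FiniteComplex.{u}) (n : ℕ) : Submodule ℤ (X.gen (n + 1) → ℤ) :=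
  LinearMap.range (X.d n).transpose.mulVecLin

/-- Reduced homology: `X.redHomology n = H̃_{n-1}(X)`. -/
abbrev redHomology (X : FiniteComplex.{u}) (n : ℕ) : Type u :=
  matrixHomology (X.d n) (X.d (n + 1))

/-- Reduced cohomology: `X.redCohomology n = H̃^{n-1}(X) = Z^{n-1} / B^{n-1}`. -/
abbrev redCohomology (X : FiniteComplex.{u}) (n : ℕ) : Type u :=
  matrixHomology (X.d (n + 1)).transpose (X.d n).transpose

/-- The unicycle condition in dimension `i`:
`rk H̃_{i+1}(X) = 0`, `rk H̃_i(X) = 1`, `rk H̃_{i-1}(X) = 0`. -/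
structure Unicycle (X : FiniteComplex.{u}) (i : ℕ) : Prop where
  rank_succ : Module.finrank ℤ (X.redHomology (i + 2)) = 0
  rank_self : Module.finrank ℤ (X.redHomology (i + 1)) = 1
  rank_pred : Module.finrank ℤ (X.redHomology i) = 0

theorem coboundaries_le_cocycles (X : FiniteComplex.{u}) (n : ℕ) :
    X.coboundaries n ≤ X.cocycles n := by
  rintro _ ⟨w, rfl⟩
  simp only [LinearMap.mem_ker, Matrix.mulVecLin_apply, Matrix.mulVec_mulVec,
    ← Matrix.transpose_mul, X.d_mul_d, Matrix.transpose_zero, Matrix.zero_mulVec]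

/-! ### Subcomplexes -/

/-- A subcomplex: a set of cells that contains every cell in the boundary of each of its cells. -/
@[ext]
structure Subcomplex (X : FiniteComplex.{u}) where
  cells : ∀ n, Finset (X.cell n)
  closed : ∀ n, ∀ e ∈ cells (n + 1), ∀ v, X.bdry n v e ≠ 0 → v ∈ cells n

namespace Subcomplex

/-- A subcomplex, as a complex in its own right. -/
def toComplex {X : FiniteComplex.{u}} (Y : X.Subcomplex) : FiniteComplex.{u} where
  cell n := {x : X.cell n // x ∈ Y.cells n}
  fintypeCell _ := inferInstance
  decEqCell _ := inferInstance
  bounded := by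
    obtain ⟨d, hd⟩ := X.bounded
    exact ⟨d, fun n hn => ⟨fun x => (hd n hn).false x.1⟩⟩
  bdry n := (X.bdry n).submatrix Subtype.val Subtype.val
  bdry_mul_bdry n := by
    ext v e
    have h := congrFun (congrFun (X.bdry_mul_bdry n) v.1) e.1
    rw [Matrix.mul_apply] at h ⊢
    simp only [Matrix.submatrix_apply, Matrix.zero_apply] at h ⊢
    rw [← h]
    refine Eq.trans ?_ (Finset.sum_subset (Finset.subset_univ (Y.cells (n + 1)))
      fun y _ hy => ?_)
    · exact Finset.sum_coe_sort (Y.cells (n + 1)) (fun y => X.bdry n v.1 y * X.bdry (n + 1) y e.1)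
    · by_contra hne
      exact hy (Y.closed (n + 1) e.1 e.2 y (right_ne_zero_of_mul hne))
  augmented e := by
    rw [← X.augmented e.1]
    refine Eq.trans ?_ (Finset.sum_subset (Finset.subset_univ (Y.cells 0)) fun y _ hy => ?_)
    · exact Finset.sum_coe_sort (Y.cells 0) (fun y => X.bdry 0 y e.1)
    · by_contra hne
      exact hy (Y.closed 0 e.1 e.2 y hne)

/-- The complement operator in dimension `i`: it keeps all cells of dimension `< i`, takes the
complementary set of `i`-cells, and has no cells of dimension `> i`. -/
def compl {X : FiniteComplex.{u}} (Y : X.Subcomplex) (i : ℕ) : X.Subcomplex where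
  cells n := if n < i then Finset.univ else if n = i then (Y.cells n)ᶜ else ∅
  closed n e he v _ := by
    have hn : n < i := by
      by_contra hn
      have h1 : ¬ n + 1 < i := by omega
      have h2 : ¬ n + 1 = i := by omega
      simp [h1, h2] at he
    simp [hn]

/-- The generators of the relative chain complex of `(X, A)`, with the degree shifted by two: the
basis of `C_{n-2}(X, A) = C_{n-2}(X) / C_{n-2}(A)` formed by the cells of `X` not in `A`. -/
abbrev relGen {X : FiniteComplex.{u}} (A : X.Subcomplex) : ℕ → Type u
  | 0 => PEmpty
  | 1 => PEmpty
  | n + 2 => {x : X.cell n // x ∉ A.cells n}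

instance {X : FiniteComplex.{u}} (A : X.Subcomplex) : ∀ n, Fintype (A.relGen n)
  | 0 => inferInstanceAs (Fintype PEmpty)
  | 1 => inferInstanceAs (Fintype PEmpty)
  | n + 2 => inferInstanceAs (Fintype {x : X.cell n // x ∉ A.cells n})

/-- The boundary matrices `∂_{n-1} : C_{n-1}(X, A) → C_{n-2}(X, A)` of the relative complex. -/
def relD {X : FiniteComplex.{u}} (A : X.Subcomplex) :
    ∀ n, Matrix (A.relGen n) (A.relGen (n + 1)) ℤ
  | 0 => 0
  | 1 => 0
  | n + 2 => (X.bdry n).submatrix Subtype.val Subtype.val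

/-- Relative cohomology: `A.relCohomology n = H^{n-1}(X, A)`, the cohomology of the dual of the
relative chain complex. -/
abbrev relCohomology {X : FiniteComplex.{u}} (A : X.Subcomplex) (n : ℕ) : Type u :=
  matrixHomology (A.relD (n + 1)).transpose (A.relD n).transpose

/-- The weight `|H̃_{i-1}(T)|` of an `i`-dimensional spanning tree, and `0` if that is infinite. -/
noncomputable def treeWeight {X : FiniteComplex.{u}} (T : X.Subcomplex) (i : ℕ) : ℕ :=
  Nat.card (T.toComplex.redHomology i)

/-- The weight `|H^{i+1}(X, Ū)|` of an `i`-dimensional dual cycletree `U`, where `Ū` is its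
complement, and `0` if that is infinite. -/
noncomputable def dualCycletreeWeight {X : FiniteComplex.{u}} (U : X.Subcomplex) (i : ℕ) : ℕ :=
  Nat.card ((U.compl i).relCohomology (i + 2))

end Subcomplex

/-- The set `𝒮_i` of the subcomplexes `Y` with `X^{i-1} ⊆ Y ⊆ X^i`. Such a `Y` is determined by its
set `Y.cells i` of `i`-cells. -/
def spanningSubcomplexes (X : FiniteComplex.{u}) (i : ℕ) : Set X.Subcomplex :=
  {Y | (∀ n < i, Y.cells n = Finset.univ) ∧ ∀ n > i, Y.cells n = ∅}

/-- The set `𝒯_i` of the `i`-dimensional spanning trees, those of zero weight included: the `T` in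
`𝒮_i` with `rk Z_{i-1}(X)` cells of dimension `i`. -/
def spanningTrees (X : FiniteComplex.{u}) (i : ℕ) : Set X.Subcomplex :=
  {T | T ∈ X.spanningSubcomplexes i ∧ (T.cells i).card = Module.finrank ℤ (X.cycles i)}

/-- The set `𝒰^i` of the `i`-dimensional dual cycletrees, those of zero weight included: the `U` in
`𝒮_i` with `rk Z^{i+1}(X) + 1` cells of dimension `i`. -/
def dualCycletrees (X : FiniteComplex.{u}) (i : ℕ) : Set X.Subcomplex :=
  {U | U ∈ X.spanningSubcomplexes i ∧
    (U.cells i).card = Module.finrank ℤ (X.cocycles (i + 2)) + 1}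

end FiniteComplex

/-! ### The cocycle part of a dual cycletree -/

/-- For an `n × (n+1)` matrix `A`, the vector with components `(-1)^j det [A]_j` for
`j = 1, …, n + 1`, where `[A]_j` is `A` without its `j`-th column (`Fin` counts from `0`). -/
def minorVector {n : ℕ} (A : Matrix (Fin n) (Fin (n + 1)) ℤ) : Fin (n + 1) → ℤ :=
  fun j => (-1) ^ (j.val + 1) * (A.submatrix id j.succAbove).det

theorem mulVec_minorVector {n : ℕ} (A : Matrix (Fin n) (Fin (n + 1)) ℤ) :
    A.mulVec (minorVector A) = 0 := by
  ext p
  let M : Matrix (Fin (n + 1)) (Fin (n + 1)) ℤ := Matrix.of (Fin.cons (A p) A)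
  have h0 : M.det = 0 := Matrix.det_zero_of_row_eq (i := 0) (j := p.succ)
    (Fin.succ_ne_zero p).symm rfl
  rw [Matrix.det_succ_row_zero] at h0
  have hsub : ∀ j : Fin (n + 1),
      M.submatrix Fin.succ j.succAbove = A.submatrix id j.succAbove := by
    intro j; rfl
  have hz : ∀ j, M 0 j = A p j := fun j => rfl
  simp only [hsub, hz] at h0
  simp only [Matrix.mulVec, dotProduct, minorVector, Pi.zero_apply]
  rw [← neg_eq_zero, ← h0, ← Finset.sum_neg_distrib]
  refine Finset.sum_congr rfl fun j _ => ?_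
  ring

/-- An integer vector divided by the gcd of its components (and `0` for the zero vector). -/
def primitivePart {ι : Type*} [Fintype ι] (v : ι → ℤ) : ι → ℤ :=
  fun x => v x / Finset.univ.gcd v

theorem gcd_smul_primitivePart {ι : Type*} [Fintype ι] (v : ι → ℤ) :
    Finset.univ.gcd v • primitivePart v = v := by
  ext x
  exact Int.mul_ediv_cancel' (Finset.gcd_dvd (Finset.mem_univ x))

namespace FiniteComplex

/-- The coboundary of the cell `x`, an element of `Z^{i+1}(X)`. -/
def cellCoboundary (X : FiniteComplex.{u}) {i : ℕ} (x : X.cell i) : X.cocycles (i + 2) :=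
  ⟨fun y => X.d (i + 2) x y, by
    ext w
    have h := congrFun (congrFun (X.d_mul_d (i + 2)) x) w
    simp only [Matrix.mulVecLin_apply, Matrix.mulVec, dotProduct, Matrix.transpose_apply,
      Pi.zero_apply]
    rw [Matrix.mul_apply] at h
    rw [Matrix.zero_apply] at h
    rw [← h]
    exact Finset.sum_congr rfl fun _ _ => mul_comm _ _⟩

/-- The matrix `[δ_i|_I]_Z`: its columns are the coboundaries of the `i`-cells in the list `cols`,
written in the basis `Z` of `Z^{i+1}(X)`. -/
noncomputable def coboundaryMatrix (X : FiniteComplex.{u}) {i m r : ℕ}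
    (Z : Module.Basis (Fin m) ℤ (X.cocycles (i + 2))) (cols : Fin r → X.cell i) :
    Matrix (Fin m) (Fin r) ℤ :=
  Matrix.of fun p q => Z.repr (X.cellCoboundary (cols q)) p

namespace Subcomplex

/-- The underlying vector of the cocycle part of `U`: the vector `minorVector` of the
`m × (m+1)` matrix `[δ_i|_{I(U)}]_Z`, extended by zero to the `i`-cells not in `U`. Here `Z` is a
basis of `Z^{i+1}(X)`, and `e` enumerates the `i`-cells of `U`. -/
noncomputable def cocyclePartVector {X : FiniteComplex.{u}} {i m : ℕ} (U : X.Subcomplex)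
    (Z : Module.Basis (Fin m) ℤ (X.cocycles (i + 2)))
    (e : Fin (m + 1) ≃ {x : X.cell i // x ∈ U.cells i}) : X.gen (i + 2) → ℤ :=
  fun x => if hx : x ∈ U.cells i then
    minorVector (X.coboundaryMatrix Z fun q => (e q).1) (e.symm ⟨x, hx⟩) else 0

theorem cocyclePartVector_mem {X : FiniteComplex.{u}} {i m : ℕ} (U : X.Subcomplex)
    (Z : Module.Basis (Fin m) ℤ (X.cocycles (i + 2)))
    (e : Fin (m + 1) ≃ {x : X.cell i // x ∈ U.cells i}) :
    U.cocyclePartVector Z e ∈ X.cocycles (i + 1) := by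
  set v := minorVector (X.coboundaryMatrix Z fun q => (e q).1) with hv
  have key : ∑ q, v q • X.cellCoboundary (e q).1 = 0 := by
    apply Z.repr.injective
    ext p
    have h := congrFun (mulVec_minorVector (X.coboundaryMatrix Z fun q => (e q).1)) p
    simp only [Matrix.mulVec, dotProduct, coboundaryMatrix, Matrix.of_apply,
      Pi.zero_apply] at h
    simp only [map_sum, map_smul, Finsupp.coe_finsetSum, Finset.sum_apply, Finsupp.smul_apply,
      smul_eq_mul, map_zero, Finsupp.coe_zero, Pi.zero_apply]
    rw [← h]
    exact Finset.sum_congr rfl fun _ _ => mul_comm _ _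
  ext y
  have hy := congrFun (congrArg Subtype.val key) y
  simp only [AddSubmonoidClass.coe_finsetSum, SetLike.val_smul, Finset.sum_apply,
    Pi.smul_apply, smul_eq_mul, ZeroMemClass.coe_zero, Pi.zero_apply] at hy
  simp only [Matrix.mulVecLin_apply, Matrix.mulVec, dotProduct, Matrix.transpose_apply,
    Pi.zero_apply]
  rw [← hy, ← Equiv.sum_comp e.symm]
  refine Eq.symm (Eq.trans ?_ (Finset.sum_subset (Finset.subset_univ (U.cells i))
    fun x _ hx => ?_))
  · rw [← Finset.sum_coe_sort (U.cells i)]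
    refine Finset.sum_congr rfl fun x _ => ?_
    have hx : x.1 ∈ U.cells i := x.2
    simp [cocyclePartVector, hx, cellCoboundary, hv, mul_comm]
  · have : U.cocyclePartVector Z e x = 0 := dif_neg hx
    rw [this, mul_zero]

/-- The cocycle part `C_U` of a dual cycletree `U`, an element of `Z^i(X)`. -/
noncomputable def cocyclePart {X : FiniteComplex.{u}} {i m : ℕ} (U : X.Subcomplex)
    (Z : Module.Basis (Fin m) ℤ (X.cocycles (i + 2)))
    (e : Fin (m + 1) ≃ {x : X.cell i // x ∈ U.cells i}) : X.cocycles (i + 1) :=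
  ⟨U.cocyclePartVector Z e, U.cocyclePartVector_mem Z e⟩

/-- The cocycle part `C_U`, divided by the gcd of its components. -/
noncomputable def primitiveCocyclePart {X : FiniteComplex.{u}} {i m : ℕ} (U : X.Subcomplex)
    (Z : Module.Basis (Fin m) ℤ (X.cocycles (i + 2)))
    (e : Fin (m + 1) ≃ {x : X.cell i // x ∈ U.cells i}) : X.cocycles (i + 1) :=
  ⟨primitivePart (U.cocyclePartVector Z e), by
    have h := gcd_smul_primitivePart (U.cocyclePartVector Z e)
    by_cases hg : Finset.univ.gcd (U.cocyclePartVector Z e) = 0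
    · have h0 : primitivePart (U.cocyclePartVector Z e) = 0 := by
        ext x; simp [primitivePart, hg]
      rw [h0]
      exact Submodule.zero_mem _
    · have hm := U.cocyclePartVector_mem Z e
      rw [← h] at hm
      rw [LinearMap.mem_ker] at hm ⊢
      rw [map_smul] at hm
      exact (smul_eq_zero.mp hm).resolve_left hg⟩

end Subcomplex

/-! ### The cutting number -/

/-- The cutting number `c(z) = det([z]_Z, [δ̄_{i-1}]_Z)` of a cocycle `z ∈ Z^i(X)`, where `Z` is a
basis of `Z^i(X)`, and the columns of `δ̄_{i-1}` are a basis `B` of the lattice `B^i(X)`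
of coboundaries, the image of `δ_{i-1}`. -/
noncomputable def cuttingNumber (X : FiniteComplex.{u}) {i k : ℕ}
    (Z : Module.Basis (Fin (k + 1)) ℤ (X.cocycles (i + 1)))
    (B : Module.Basis (Fin k) ℤ (X.coboundaries (i + 1)))
    (z : X.cocycles (i + 1)) : ℤ :=
  (Matrix.of fun p q : Fin (k + 1) => Z.repr
    ((Fin.cons z fun j => Submodule.inclusion (X.coboundaries_le_cocycles (i + 1)) (B j) :
      Fin (k + 1) → X.cocycles (i + 1)) q) p).det

end FiniteComplex

/-! Every quantity is a lattice index, with an infinite index counted as `0`, so weight zero mostly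
needs no separate treatment. Let π restrict `i`-cochains to the cells of T, so that ker π consists
of the cochains supported on U. Put p = [ℤ^{I(T)} : π(Z^i)] and h = |H̃^{i+1}(X)|.

The weight of U is [Z^{i+1} : δ_i(ker π)], and `relIndex_map_ker` turns it into p·h. The weight of T
is [ℤ^{I(T)} : π(B^i)] by a transposition argument
(`card_matrixHomology_eq_index_map_restrictCoords`), and `index_map_of_le` splits it as q·p with q =
[Z^i : B^i + (ker π ∩ Z^i)]. If C_U ≠ 0, then ker π ∩ Z^i is generated by the primitive cocycle
part, so q is the absolute value of its cutting number. Hence both sides of the second equality are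
q·p·h.

The first equality is linearity of the cutting number, once wt(U) is known to be the gcd of the
coefficients of C_U. This is `index_range_mulVecLin_eq_gcd`: the columns of an n × (n+1) matrix span
a lattice whose index is the gcd of the maximal minors. The vanishing criterion follows because h is
finite and nonzero. The bijection is a count of ranks. -/

/-! ### Lattice indices and determinants. -/

theorem index_range_mulVecLin_eq_zero {m n : Type*} [Fintype m] [Fintype n]
    (A : Matrix m n ℤ) {r : m → ℤ} (hr : r ≠ 0) (hrA : Matrix.vecMul r A = 0) :
    (LinearMap.range A.mulVecLin).toAddSubgroup.index = 0 := by
  by_contra h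
  -- If the index were finite, a nonzero multiple of `r` would lie in the lattice, hence be
  -- orthogonal to `r`, forcing `r ⬝ᵥ r = 0`.
  obtain ⟨x, hx⟩ := AddSubgroup.nsmul_index_mem
    (H := (LinearMap.range A.mulVecLin).toAddSubgroup) r
  have h1 : r ⬝ᵥ A.mulVec x = 0 := by
    rw [Matrix.dotProduct_mulVec, hrA, zero_dotProduct]
  rw [← Matrix.mulVecLin_apply, hx, dotProduct_smul, smul_eq_zero] at h1
  rcases h1 with h1 | h1
  · exact h h1
  · exact hr (dotProduct_self_eq_zero.mp h1)

theorem index_range_mulVecLin {n : Type*} [Fintype n] [DecidableEq n] (M : Matrix n n ℤ) :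
    (LinearMap.range M.mulVecLin).toAddSubgroup.index = M.det.natAbs := by
  by_cases h : M.det = 0
  · obtain ⟨r, hr, hrM⟩ := Matrix.exists_vecMul_eq_zero_iff.mpr h
    rw [index_range_mulVecLin_eq_zero M hr hrM, h, Int.natAbs_zero]
  · have hinj : Function.Injective M.mulVecLin := by
      rw [← LinearMap.ker_eq_bot, LinearMap.ker_eq_bot']
      intro v hv
      by_contra hne
      exact h (Matrix.exists_mulVec_eq_zero_iff.mp ⟨v, hne, hv⟩)
    have h1 := Submodule.natAbs_det_equiv (LinearMap.range M.mulVecLin)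
      (LinearEquiv.ofInjective M.mulVecLin hinj)
    have h2 : (LinearMap.range M.mulVecLin).subtype ∘ₗ AddMonoidHom.toIntLinearMap
        (LinearEquiv.ofInjective M.mulVecLin hinj : (n → ℤ) →+ LinearMap.range M.mulVecLin) =
        Matrix.toLin' M := by
      ext; rfl
    rw [h2, LinearMap.det_toLin'] at h1
    exact h1.symm

/-! ### Maximal minors of an n × (n+1) matrix. -/

/-- Laplace expansion along the added row; the minus sign arises because `minorVector` numbers its
signs from 1. Bordering `A` by a suitable row is the device behind the lemmas of this part. -/
theorem det_cons_eq_neg_dotProduct_minorVector {n : ℕ} (w : Fin (n + 1) → ℤ)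
    (A : Matrix (Fin n) (Fin (n + 1)) ℤ) :
    (Matrix.of (Fin.cons w A : Fin (n + 1) → Fin (n + 1) → ℤ)).det = -(w ⬝ᵥ minorVector A) := by
  rw [Matrix.det_succ_row_zero, dotProduct, ← Finset.sum_neg_distrib]
  refine Finset.sum_congr rfl fun j _ => ?_
  have hsub : (Matrix.of (Fin.cons w A : Fin (n + 1) → Fin (n + 1) → ℤ)).submatrix
      Fin.succ j.succAbove = A.submatrix id j.succAbove := rfl
  rw [hsub, minorVector]
  have hz : (Matrix.of (Fin.cons w A : Fin (n + 1) → Fin (n + 1) → ℤ)) 0 j = w j := rfl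
  rw [hz]
  ring

theorem mulVec_cons {n : ℕ} (w : Fin (n + 1) → ℤ) (A : Matrix (Fin n) (Fin (n + 1)) ℤ)
    (v : Fin (n + 1) → ℤ) :
    (Matrix.of (Fin.cons w A : Fin (n + 1) → Fin (n + 1) → ℤ)).mulVec v =
      Fin.cons (w ⬝ᵥ v) (A.mulVec v) := by
  ext p
  refine Fin.cases ?_ (fun p => ?_) p <;> rfl

theorem gcd_ne_zero_of_ne_zero {ι : Type*} [Fintype ι] {v : ι → ℤ} (hv : v ≠ 0) :
    Finset.univ.gcd v ≠ 0 := fun h =>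
  hv (funext fun x => Finset.gcd_eq_zero_iff.mp h x (Finset.mem_univ x))

theorem exists_dotProduct_primitivePart_eq_one {ι : Type*} [Fintype ι] {v : ι → ℤ} (hv : v ≠ 0) :
    ∃ w : ι → ℤ, w ⬝ᵥ v = Finset.univ.gcd v ∧ w ⬝ᵥ primitivePart v = 1 := by
  obtain ⟨w, hw⟩ := Finset.univ.gcd_eq_sum_mul v
  have h1 : w ⬝ᵥ v = Finset.univ.gcd v := by
    rw [hw, dotProduct_comm]; rfl
  refine ⟨w, h1, ?_⟩
  have h2 : Finset.univ.gcd v * (w ⬝ᵥ primitivePart v) = Finset.univ.gcd v * 1 := by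
    rw [← smul_eq_mul, ← dotProduct_smul, gcd_smul_primitivePart, h1, mul_one]
  exact mul_left_cancel₀ (gcd_ne_zero_of_ne_zero hv) h2

theorem mulVec_primitivePart_minorVector {n : ℕ} (A : Matrix (Fin n) (Fin (n + 1)) ℤ) :
    A.mulVec (primitivePart (minorVector A)) = 0 := by
  by_cases hC : minorVector A = 0
  · have h0 : primitivePart (minorVector A) = 0 := by
      ext x; simp [primitivePart, hC]
    rw [h0, Matrix.mulVec_zero]
  · have h := mulVec_minorVector A
    rw [← gcd_smul_primitivePart (minorVector A), Matrix.mulVec_smul] at h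
    exact (smul_eq_zero.mp h).resolve_left (gcd_ne_zero_of_ne_zero hC)

/-- Border `A` by a Bézout row `w` for the minors. The difference of `v` and its candidate multiple
is killed by `A` and by `w`, while the bordered determinant is minus the gcd, which is nonzero. -/
theorem eq_smul_primitivePart_minorVector {n : ℕ} {A : Matrix (Fin n) (Fin (n + 1)) ℤ}
    (hA : minorVector A ≠ 0) {v : Fin (n + 1) → ℤ} (hv : A.mulVec v = 0) :
    ∃ c : ℤ, v = c • primitivePart (minorVector A) := by
  obtain ⟨w, hw, hw1⟩ := exists_dotProduct_primitivePart_eq_one hA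
  refine ⟨w ⬝ᵥ v, ?_⟩
  by_contra hne
  have hdet := Matrix.exists_mulVec_eq_zero_iff.mp
    ⟨v - (w ⬝ᵥ v) • primitivePart (minorVector A), sub_ne_zero.mpr hne, by
      rw [mulVec_cons w A, Matrix.mulVec_sub, Matrix.mulVec_smul, hv,
        mulVec_primitivePart_minorVector, dotProduct_sub, dotProduct_smul, hw1]
      ext p
      refine Fin.cases ?_ (fun p => ?_) p <;> simp⟩
  rw [det_cons_eq_neg_dotProduct_minorVector, hw, neg_eq_zero] at hdet
  exact gcd_ne_zero_of_ne_zero hA hdet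

/-- Bordering by zero yields a kernel vector `v ≠ 0` of `A`. Bordering by `v` itself is singular
too, as all minors vanish. In the resulting row relation, pairing with `v` kills the coefficient of
the added row, which leaves a relation among the rows of `A`. -/
theorem exists_vecMul_eq_zero_of_minorVector_eq_zero {n : ℕ} {A : Matrix (Fin n) (Fin (n + 1)) ℤ}
    (hA : minorVector A = 0) : ∃ r : Fin n → ℤ, r ≠ 0 ∧ Matrix.vecMul r A = 0 := by
  obtain ⟨v, hv, hAv⟩ := Matrix.exists_mulVec_eq_zero_iff.mpr
    (show (Matrix.of (Fin.cons 0 A : Fin (n + 1) → Fin (n + 1) → ℤ)).det = 0 by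
      rw [det_cons_eq_neg_dotProduct_minorVector, zero_dotProduct, neg_zero])
  rw [mulVec_cons] at hAv
  have hAv : A.mulVec v = 0 := funext fun p => congrFun hAv p.succ
  obtain ⟨r, hr, hrM⟩ := Matrix.exists_vecMul_eq_zero_iff.mpr
    (show (Matrix.of (Fin.cons v A : Fin (n + 1) → Fin (n + 1) → ℤ)).det = 0 by
      rw [det_cons_eq_neg_dotProduct_minorVector, hA, dotProduct_zero, neg_zero])
  have hsplit : Matrix.vecMul r (Matrix.of (Fin.cons v A : Fin (n + 1) → Fin (n + 1) → ℤ)) =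
      r 0 • v + Matrix.vecMul (Fin.tail r) A := by
    ext j
    simp only [Matrix.vecMul, dotProduct, Fin.sum_univ_succ, Pi.add_apply, Pi.smul_apply]
    rfl
  rw [hsplit] at hrM
  have h0 : r 0 = 0 := by
    have h := congrArg (· ⬝ᵥ v) hrM
    simp only [add_dotProduct, smul_dotProduct, ← Matrix.dotProduct_mulVec, hAv, dotProduct_zero,
      zero_dotProduct, add_zero, smul_eq_mul, mul_eq_zero] at h
    exact h.resolve_right fun h => hv (dotProduct_self_eq_zero.mp h)
  rw [h0, zero_smul, zero_add] at hrM
  refine ⟨Fin.tail r, fun ht => hr (funext fun p => ?_), hrM⟩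
  exact Fin.cases h0 (fun p => congrFun ht p) p

/-- The index of the lattice spanned by the columns of an `n × (n+1)` matrix is the gcd of its
maximal minors. -/
theorem index_range_mulVecLin_eq_gcd {n : ℕ} (A : Matrix (Fin n) (Fin (n + 1)) ℤ) :
    (LinearMap.range A.mulVecLin).toAddSubgroup.index =
      (Finset.univ.gcd (minorVector A)).natAbs := by
  by_cases hA : minorVector A = 0
  · obtain ⟨r, hr, hrA⟩ := exists_vecMul_eq_zero_of_minorVector_eq_zero hA
    rw [index_range_mulVecLin_eq_zero A hr hrA, Finset.gcd_eq_zero_iff.mpr, Int.natAbs_zero]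
    exact fun x _ => congrFun hA x
  · obtain ⟨w, hw, hw1⟩ := exists_dotProduct_primitivePart_eq_one hA
    set M := Matrix.of (Fin.cons w A : Fin (n + 1) → Fin (n + 1) → ℤ) with hM
    have hdet := index_range_mulVecLin M
    rw [det_cons_eq_neg_dotProduct_minorVector, hw, Int.natAbs_neg] at hdet
    rw [← hdet]
    let p : (Fin (n + 1) → ℤ) →+ (Fin n → ℤ) := (LinearMap.funLeft ℤ ℤ Fin.succ).toAddMonoidHom
    have hp : Function.Surjective p := fun y => ⟨Fin.cons 0 y, rfl⟩
    have hmap : (LinearMap.range A.mulVecLin).toAddSubgroup =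
        (LinearMap.range M.mulVecLin).toAddSubgroup.map p := by
      ext y
      constructor
      · rintro ⟨x, rfl⟩
        exact ⟨_, ⟨x, rfl⟩, rfl⟩
      · rintro ⟨_, ⟨x, rfl⟩, rfl⟩
        exact ⟨x, rfl⟩
    rw [hmap]
    -- Dropping the first coordinate preserves the index because its kernel lies in the range of
    -- `M`: the primitive kernel vector of `A` maps to the first unit vector, since `w` pairs to 1
    -- with it.
    refine AddSubgroup.index_map_eq _ hp fun x hx => ⟨x 0 • primitivePart (minorVector A), ?_⟩
    rw [Matrix.mulVecLin_apply, Matrix.mulVec_smul, hM, mulVec_cons, hw1,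
      mulVec_primitivePart_minorVector]
    ext q
    refine Fin.cases ?_ (fun q => ?_) q
    · simp
    · have := congrFun (show (fun q : Fin n => x q.succ) = 0 from hx) q
      simpa using this.symm

/-! ### Index formulas for homomorphisms. -/

/-- The index of f(ker p) in f(L) and that of p(ker f) in P both equal [L : ker p + ker f]. -/
theorem relIndex_map_ker {L P L' : Type*} [AddCommGroup L] [AddCommGroup P] [AddCommGroup L']
    {p : L →+ P} (hp : Function.Surjective p) (f : L →+ L') {K : AddSubgroup L'}
    (hK : f.range ≤ K) :
    (p.ker.map f).relIndex K = (f.ker.map p).index * f.range.relIndex K := by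
  rw [← AddSubgroup.relIndex_mul_relIndex _ f.range K (AddSubgroup.map_le_range _ _) hK,
    AddMonoidHom.range_eq_map f, AddSubgroup.relIndex_map_map, AddSubgroup.index_map,
    AddMonoidHom.range_eq_top_of_surjective p hp, AddSubgroup.index_top, mul_one, top_sup_eq,
    AddSubgroup.relIndex_top_right, sup_comm]

/-- Pulling back along `p` gives [p(Z) : p(B)] = [Z : (B + ker p) ∩ Z], and the modular law rewrites
the intersection. -/
theorem index_map_of_le {L P : Type*} [AddCommGroup L] [AddCommGroup P]
    (p : L →+ P) {B Z : AddSubgroup L} (hB : B ≤ Z) :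
    (B.map p).index = (B ⊔ p.ker ⊓ Z).relIndex Z * (Z.map p).index := by
  rw [← AddSubgroup.relIndex_mul_index (AddSubgroup.map_mono hB), AddSubgroup.relIndex_map_map]
  congr 1
  rw [← sup_inf_assoc_of_le _ hB, AddSubgroup.inf_relIndex_right,
    ← AddSubgroup.relIndex_sup_right (H := Z) (K := B ⊔ p.ker)]
  congr 1
  rw [← sup_assoc, sup_eq_left.mpr hB]

/-! ### Ranks of integer matrices and homology. -/

theorem Matrix.rank_add_finrank_ker {m n : Type*} [Fintype m] [Fintype n] (A : Matrix m n ℤ) :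
    A.rank + Module.finrank ℤ (LinearMap.ker A.mulVecLin) = Fintype.card n := by
  have h := (LinearMap.ker A.mulVecLin).finrank_quotient_add_finrank
  rw [A.mulVecLin.quotKerEquivRange.finrank_eq, Module.finrank_fintype_fun_eq_card] at h
  exact h

theorem Matrix.rank_le_rank_transpose_int {m n : Type*} [Fintype m] [Fintype n]
    (A : Matrix m n ℤ) : A.rank ≤ A.transpose.rank := by
  -- By positivity of the dot product, `Aᵀ A x = 0` forces `A x = 0`.
  have hker : LinearMap.ker (A.transpose * A).mulVecLin = LinearMap.ker A.mulVecLin := by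
    ext x
    simp only [LinearMap.mem_ker, Matrix.mulVecLin_apply, ← Matrix.mulVec_mulVec]
    constructor
    · intro h
      replace h := congr_arg (dotProduct x) h
      rwa [Matrix.dotProduct_mulVec, dotProduct_zero, Matrix.vecMul_transpose,
        dotProduct_self_eq_zero] at h
    · intro h
      rw [h, Matrix.mulVec_zero]
  have h1 := (A.transpose * A).rank_add_finrank_ker
  rw [hker, ← A.rank_add_finrank_ker] at h1
  rw [← Nat.add_right_cancel h1]
  exact Matrix.rank_mul_le_left _ _

theorem Matrix.rank_transpose_int {m n : Type*} [Fintype m] [Fintype n] (A : Matrix m n ℤ) :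
    A.transpose.rank = A.rank :=
  le_antisymm A.transpose.rank_le_rank_transpose_int A.rank_le_rank_transpose_int

theorem card_matrixHomology {l m n : Type*} [Fintype m] [Fintype n]
    (A : Matrix l m ℤ) (B : Matrix m n ℤ) :
    Nat.card (matrixHomology A B) = (LinearMap.range B.mulVecLin).toAddSubgroup.relIndex
      (LinearMap.ker A.mulVecLin).toAddSubgroup := rfl

theorem finrank_matrixHomology {l m n : Type*} [Fintype l] [Fintype m] [Fintype n]
    {A : Matrix l m ℤ} {B : Matrix m n ℤ} (h : A * B = 0) :
    Module.finrank ℤ (matrixHomology A B) + A.rank + B.rank = Fintype.card m := by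
  have hle : LinearMap.range B.mulVecLin ≤ LinearMap.ker A.mulVecLin := by
    rintro _ ⟨x, rfl⟩
    simp [Matrix.mulVec_mulVec, h]
  have h1 := ((LinearMap.range B.mulVecLin).submoduleOf
    (LinearMap.ker A.mulVecLin)).finrank_quotient_add_finrank
  rw [(Submodule.submoduleOfEquivOfLe hle).finrank_eq] at h1
  have h2 := A.rank_add_finrank_ker
  have h3 : B.rank = Module.finrank ℤ (LinearMap.range B.mulVecLin) := rfl
  unfold matrixHomology
  omega

theorem card_matrixHomology_submatrix {l m n l' m' n' : Type*} [Fintype m] [Fintype n]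
    [Fintype m'] [Fintype n'] (A : Matrix l m ℤ) (B : Matrix m n ℤ)
    (a : l' ≃ l) (b : m' ≃ m) (c : n' ≃ n) :
    Nat.card (matrixHomology (A.submatrix a b) (B.submatrix b c)) =
      Nat.card (matrixHomology A B) := by
  rw [card_matrixHomology, card_matrixHomology]
  let f : (m → ℤ) →+ (m' → ℤ) := (LinearMap.funLeft ℤ ℤ b).toAddMonoidHom
  have hf : Function.Injective f := LinearMap.funLeft_injective_of_surjective ℤ ℤ b b.surjective
  rw [← AddSubgroup.relIndex_map_map_of_injective _ _ hf]
  congr 1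
  · ext y
    constructor
    · rintro ⟨x, rfl⟩
      refine ⟨_, ⟨x ∘ c.symm, rfl⟩, ?_⟩
      exact (Matrix.submatrix_mulVec_equiv B x b c).symm
    · rintro ⟨_, ⟨x, rfl⟩, rfl⟩
      refine ⟨x ∘ c, ?_⟩
      refine (Matrix.submatrix_mulVec_equiv B (x ∘ c) b c).trans ?_
      rw [Function.comp_assoc, Equiv.self_comp_symm, Function.comp_id]
      rfl
  · ext y
    have hy : (A.submatrix a b).mulVec y = A.mulVec (y ∘ b.symm) ∘ a :=
      Matrix.submatrix_mulVec_equiv A y a b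
    constructor
    · intro h
      refine ⟨y ∘ b.symm, ?_, ?_⟩
      · have h : (A.submatrix a b).mulVec y = 0 := h
        rw [hy] at h
        exact a.surjective.injective_comp_right (h.trans (Pi.zero_comp a).symm)
      · change (y ∘ b.symm) ∘ b = y
        rw [Function.comp_assoc, Equiv.symm_comp_self, Function.comp_id]
    · rintro ⟨x, hx, rfl⟩
      have hx : A.mulVec x = 0 := hx
      refine (Matrix.submatrix_mulVec_equiv A (x ∘ b) a b).trans ?_
      rw [Function.comp_assoc, Equiv.self_comp_symm, Function.comp_id, hx]
      rfl

/-! ### Coordinate restriction and transposition. -/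

/-- The restriction of integer vectors to a set of coordinates. -/
abbrev restrictCoords {n : Type*} (T : Finset n) : (n → ℤ) →+ ({x // x ∈ T} → ℤ) :=
  (LinearMap.funLeft ℤ ℤ (Subtype.val : {x // x ∈ T} → n)).toAddMonoidHom

theorem restrictCoords_surjective {n : Type*} (T : Finset n) :
    Function.Surjective (restrictCoords T) :=
  LinearMap.funLeft_surjective_of_injective ℤ ℤ _ Subtype.val_injective

theorem mem_ker_restrictCoords {n : Type*} {T : Finset n} {v : n → ℤ} :
    v ∈ (restrictCoords T).ker ↔ ∀ x ∈ T, v x = 0 :=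
  ⟨fun h x hx => congrFun (show (fun y : {x // x ∈ T} => v y) = 0 from h) ⟨x, hx⟩,
    fun h => funext fun x => h x.1 x.2⟩

theorem relIndex_span_range {M p n : Type*} [AddCommGroup M] [Fintype p] [Fintype n]
    {Z : Submodule ℤ M} (b : Module.Basis p ℤ Z) (v : n → Z) :
    (Submodule.span ℤ (Set.range fun q => (v q : M))).toAddSubgroup.relIndex Z.toAddSubgroup =
      (LinearMap.range (Matrix.of fun p q => b.repr (v q) p).mulVecLin).toAddSubgroup.index := by
  have h1 : LinearMap.range (Matrix.of fun p q => b.repr (v q) p).mulVecLin =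
      (Submodule.span ℤ (Set.range v)).map b.equivFun.toLinearMap := by
    rw [Matrix.range_mulVecLin, Submodule.map_span, ← Set.range_comp]
    rfl
  have h2 : Submodule.span ℤ (Set.range fun q => (v q : M)) =
      (Submodule.span ℤ (Set.range v)).map Z.subtype := by
    rw [Submodule.map_span, ← Set.range_comp]
    rfl
  have h3 : (Submodule.span ℤ (Set.range fun q => (v q : M))).toAddSubgroup.addSubgroupOf
      Z.toAddSubgroup = (Submodule.span ℤ (Set.range v)).toAddSubgroup := by
    rw [h2]
    ext x
    constructor
    · rintro ⟨y, hy, hyx⟩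
      rwa [← Subtype.ext hyx]
    · exact fun hx => ⟨x, hx, rfl⟩
  rw [AddSubgroup.relIndex, h3, h1]
  exact (AddSubgroup.index_map_of_bijective (f := b.equivFun.toLinearMap.toAddMonoidHom)
    b.equivFun.bijective _).symm

/-- The image of `f` lies in a free module of finite rank, so it is projective and `f` splits over
it. Thus the kernel is a direct summand, and functionals on it extend to `M`. -/
theorem LinearMap.exists_retraction_ker {M N : Type*} [AddCommGroup M] [AddCommGroup N]
    [Module.Free ℤ N] [Module.Finite ℤ N] (f : M →ₗ[ℤ] N) :
    ∃ r : M →ₗ[ℤ] LinearMap.ker f, ∀ z : LinearMap.ker f, r z = z := by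
  obtain ⟨s, hs⟩ := Module.projective_lifting_property f.rangeRestrict LinearMap.id
    f.surjective_rangeRestrict
  have hs' : ∀ y, f (s y) = y := fun y => congrArg Subtype.val (LinearMap.congr_fun hs y)
  refine ⟨(LinearMap.id - s ∘ₗ f.rangeRestrict).codRestrict _ fun v => by
    rw [LinearMap.mem_ker, LinearMap.sub_apply, map_sub, LinearMap.comp_apply, hs']
    exact sub_self (f v), fun z => ?_⟩
  have hz : f.rangeRestrict z = 0 := Subtype.ext z.2
  ext1
  rw [LinearMap.codRestrict_apply, LinearMap.sub_apply, LinearMap.comp_apply, hz, map_zero,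
    sub_zero, LinearMap.id_apply]

theorem exists_dotProduct_eq_of_basis_ker {l m p : Type*} [Fintype l] [Fintype m]
    {A : Matrix l m ℤ} (b : Module.Basis p ℤ (LinearMap.ker A.mulVecLin)) (c : p → ℤ) :
    ∃ w : m → ℤ, ∀ j, w ⬝ᵥ (b j : m → ℤ) = c j := by
  classical
  obtain ⟨r, hr⟩ := A.mulVecLin.exists_retraction_ker
  obtain ⟨ψ, hψ⟩ : ∃ ψ : (m → ℤ) →ₗ[ℤ] ℤ, ∀ j, ψ (b j) = c j :=
    ⟨b.constr ℤ c ∘ₗ r, fun j => by rw [LinearMap.comp_apply, hr, b.constr_basis]⟩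
  refine ⟨fun y => ψ (Pi.single y 1), fun j => ?_⟩
  rw [← hψ j]
  conv_rhs => rw [← Finset.univ_sum_single (b j : m → ℤ), map_sum]
  refine Finset.sum_congr rfl fun y _ => ?_
  rw [mul_comm, ← smul_eq_mul, ← map_smul, ← Pi.single_smul, smul_eq_mul, mul_one]

/-- If `T` has as many elements as the rank of `ker A`, then `B` restricted to the columns in `T`
and `Bᵀ` restricted to the rows in `T` have cokernels of the same order. -/
theorem card_matrixHomology_eq_index_map_restrictCoords {l m n : Type*} [Fintype l] [Fintype m]
    [Fintype n] {A : Matrix l m ℤ} {B : Matrix m n ℤ} (hAB : A * B = 0)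
    (T : Finset n) (hT : T.card = Module.finrank ℤ (LinearMap.ker A.mulVecLin)) :
    Nat.card (matrixHomology A (B.submatrix id (Subtype.val : {x // x ∈ T} → n))) =
      ((LinearMap.range B.transpose.mulVecLin).toAddSubgroup.map (restrictCoords T)).index := by
  classical
  -- Indexing the basis by `T` makes the coordinate matrix `Q` square, so that `Q` and its transpose
  -- have the same determinant.
  let b : Module.Basis {x // x ∈ T} ℤ (LinearMap.ker A.mulVecLin) :=
    (Module.finBasisOfFinrankEq ℤ (LinearMap.ker A.mulVecLin) hT.symm).reindex T.equivFin.symm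
  have hcol : ∀ x, B.col x ∈ LinearMap.ker A.mulVecLin := fun x => by
    ext y
    exact congrFun (congrFun hAB y) x
  let Q : Matrix {x // x ∈ T} {x // x ∈ T} ℤ := Matrix.of fun p q => b.repr ⟨B.col q, hcol q⟩ p
  have hB : ∀ (y : m) (x : {x // x ∈ T}), B y x = ∑ j, Q j x * (b j : m → ℤ) y := by
    intro y x
    have h := congrArg Subtype.val (b.sum_repr ⟨B.col x, hcol x⟩)
    have h := congrFun h y
    simp only [AddSubmonoidClass.coe_finsetSum, SetLike.val_smul, Finset.sum_apply,
      Pi.smul_apply, smul_eq_mul] at h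
    exact h.symm
  have hres : ∀ w : m → ℤ, restrictCoords T (B.transpose.mulVec w) =
      Q.transpose.mulVec fun j => w ⬝ᵥ (b j : m → ℤ) := by
    intro w
    ext x
    change ∑ y, B y x * w y = ∑ j, Q j x * ∑ y, w y * (b j : m → ℤ) y
    simp only [hB, Finset.sum_mul, Finset.mul_sum]
    rw [Finset.sum_comm]
    exact Finset.sum_congr rfl fun j _ => Finset.sum_congr rfl fun y _ => by ring
  have hmap : (LinearMap.range B.transpose.mulVecLin).toAddSubgroup.map (restrictCoords T) =
      (LinearMap.range Q.transpose.mulVecLin).toAddSubgroup := by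
    ext c
    constructor
    · rintro ⟨_, ⟨w, rfl⟩, rfl⟩
      exact ⟨_, (hres w).symm⟩
    · rintro ⟨c, rfl⟩
      -- Every vector of pairings with the basis is realized, so the restricted coboundaries fill
      -- the whole range of `Qᵀ`.
      obtain ⟨w, hw⟩ := exists_dotProduct_eq_of_basis_ker b c
      refine ⟨_, ⟨w, rfl⟩, (hres w).trans ?_⟩
      rw [funext hw]
      rfl
  rw [hmap, index_range_mulVecLin, Matrix.det_transpose, ← index_range_mulVecLin,
    ← relIndex_span_range b fun q : {x // x ∈ T} => ⟨B.col q, hcol q⟩, card_matrixHomology,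
    Matrix.range_mulVecLin]
  rfl

theorem range_submatrix_mulVecLin {m n : Type*} [Fintype n] (B : Matrix m n ℤ)
    (U T : Finset n) (hU : ∀ x, x ∈ U ↔ x ∉ T) :
    (LinearMap.range (B.submatrix id (Subtype.val : {x // x ∈ U} → n)).mulVecLin).toAddSubgroup =
      (restrictCoords T).ker.map B.mulVecLin.toAddMonoidHom := by
  classical
  have key : ∀ v : n → ℤ, (∀ x ∈ T, v x = 0) →
      (B.submatrix id (Subtype.val : {x // x ∈ U} → n)).mulVec (fun x => v x) = B.mulVec v := by
    intro v hv
    ext y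
    change ∑ x : {x // x ∈ U}, B y x * v x = ∑ x, B y x * v x
    rw [Finset.sum_coe_sort U fun x => B y x * v x]
    refine Finset.sum_subset (Finset.subset_univ U) fun x _ hx => ?_
    rw [hv x (by simpa [hU] using hx), mul_zero]
  ext y
  constructor
  · rintro ⟨w, rfl⟩
    have hv : ∀ x ∈ T, (fun x => if h : x ∈ U then w ⟨x, h⟩ else 0) x = 0 := fun x hx =>
      dif_neg fun h => (hU x).mp h hx
    refine ⟨_, mem_ker_restrictCoords.mpr hv, (key _ hv).symm.trans ?_⟩
    congr 1
    ext x
    exact dif_pos x.2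
  · rintro ⟨v, hv, rfl⟩
    exact ⟨_, key v (mem_ker_restrictCoords.mp hv)⟩

theorem gcd_univ_extend {ι κ : Type*} [Fintype ι] [Fintype κ] {v : ι → ℤ} {w : κ → ℤ}
    (h : Set.range v ⊆ Set.range w ∪ {0}) (h' : Set.range w ⊆ Set.range v) :
    Finset.univ.gcd v = Finset.univ.gcd w := by
  have h1 : Finset.univ.gcd v ∣ Finset.univ.gcd w := Finset.dvd_gcd fun y _ => by
    obtain ⟨x, hx⟩ := h' ⟨y, rfl⟩
    rw [← hx]
    exact Finset.gcd_dvd (Finset.mem_univ x)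
  have h2 : Finset.univ.gcd w ∣ Finset.univ.gcd v := Finset.dvd_gcd fun x _ => by
    rcases h ⟨x, rfl⟩ with ⟨y, hy⟩ | hx
    · rw [← hy]
      exact Finset.gcd_dvd (Finset.mem_univ y)
    · rw [show v x = 0 from hx]
      exact dvd_zero _
  -- Mutual divisibility determines integers only up to sign; normalization removes the ambiguity.
  rw [← Finset.normalize_gcd, ← Finset.normalize_gcd (f := w)]
  exact normalize_eq_normalize h1 h2

/-! ### Complements and the count of cells. -/

namespace FiniteComplex

namespace Subcomplex

theorem compl_mem_spanningSubcomplexes {X : FiniteComplex.{u}} (Y : X.Subcomplex) (i : ℕ) :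
    Y.compl i ∈ X.spanningSubcomplexes i := by
  refine ⟨fun n hn => ?_, fun n hn => ?_⟩
  · simp [compl, hn]
  · simp [compl, hn.not_gt, hn.ne']

theorem compl_cells_self {X : FiniteComplex.{u}} (Y : X.Subcomplex) (i : ℕ) :
    (Y.compl i).cells i = (Y.cells i)ᶜ := by
  simp [compl]

theorem compl_compl {X : FiniteComplex.{u}} {Y : X.Subcomplex} {i : ℕ}
    (hY : Y ∈ X.spanningSubcomplexes i) : (Y.compl i).compl i = Y := by
  ext n x
  rcases lt_trichotomy n i with hn | rfl | hn
  · rw [((Y.compl i).compl_mem_spanningSubcomplexes i).1 n hn, hY.1 n hn]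
  · rw [compl_cells_self, compl_cells_self, _root_.compl_compl]
  · rw [((Y.compl i).compl_mem_spanningSubcomplexes i).2 n hn, hY.2 n hn]

end Subcomplex

/-- The vanishing ranks give rk Z_{i-1} = rk ∂_i and rk Z^{i+1} = rk ∂_{i+1}; the remaining `i`-cell
accounts for rk H̃_i = 1. -/
theorem Unicycle.finrank_cycles_add {X : FiniteComplex.{u}} {i : ℕ} (hX : X.Unicycle i) :
    Module.finrank ℤ (X.cycles i) + (Module.finrank ℤ (X.cocycles (i + 2)) + 1) =
      Fintype.card (X.cell i) := by
  have h0 : Module.finrank ℤ (X.redHomology i) + (X.d i).rank + (X.d (i + 1)).rank =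
    Fintype.card (X.gen (i + 1)) := finrank_matrixHomology (X.d_mul_d i)
  have h1 : Module.finrank ℤ (X.redHomology (i + 1)) + (X.d (i + 1)).rank + (X.d (i + 2)).rank =
    Fintype.card (X.cell i) := finrank_matrixHomology (X.d_mul_d (i + 1))
  have h2 : Module.finrank ℤ (X.redHomology (i + 2)) + (X.d (i + 2)).rank + (X.d (i + 3)).rank =
    Fintype.card (X.gen (i + 3)) := finrank_matrixHomology (X.d_mul_d (i + 2))
  have h3 : (X.d i).rank + Module.finrank ℤ (X.cycles i) = Fintype.card (X.gen (i + 1)) :=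
    (X.d i).rank_add_finrank_ker
  have h4 : (X.d (i + 3)).transpose.rank + Module.finrank ℤ (X.cocycles (i + 2)) =
    Fintype.card (X.gen (i + 3)) := (X.d (i + 3)).transpose.rank_add_finrank_ker
  rw [Matrix.rank_transpose_int] at h4
  rw [hX.rank_pred] at h0
  rw [hX.rank_self] at h1
  rw [hX.rank_succ] at h2
  omega

theorem transpose_d_mul_transpose_d (X : FiniteComplex.{u}) (n : ℕ) :
    (X.d (n + 1)).transpose * (X.d n).transpose = 0 := by
  rw [← Matrix.transpose_mul, X.d_mul_d, Matrix.transpose_zero]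

theorem Unicycle.finite_redCohomology {X : FiniteComplex.{u}} {i : ℕ} (hX : X.Unicycle i) :
    Finite (X.redCohomology (i + 2)) := by
  have h1 : Module.finrank ℤ (X.redHomology (i + 2)) + (X.d (i + 2)).rank + (X.d (i + 3)).rank =
    Fintype.card (X.gen (i + 3)) := finrank_matrixHomology (X.d_mul_d (i + 2))
  have h2 : Module.finrank ℤ (X.redCohomology (i + 2)) + (X.d (i + 3)).transpose.rank +
    (X.d (i + 2)).transpose.rank = Fintype.card (X.gen (i + 3)) :=
    finrank_matrixHomology (X.transpose_d_mul_transpose_d (i + 2))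
  rw [Matrix.rank_transpose_int, Matrix.rank_transpose_int] at h2
  rw [hX.rank_succ] at h1
  have h0 : Module.finrank ℤ (X.redCohomology (i + 2)) = 0 := by omega
  exact Module.finite_of_fg_torsion _ (Module.finrank_eq_zero_iff_isTorsion.mp h0)

theorem Unicycle.bijOn_compl {X : FiniteComplex.{u}} {i : ℕ} (hX : X.Unicycle i) :
    Set.BijOn (fun U : X.Subcomplex => U.compl i) (X.dualCycletrees i) (X.spanningTrees i) := by
  have h := hX.finrank_cycles_add
  refine ⟨fun U hU => ⟨U.compl_mem_spanningSubcomplexes i, ?_⟩, fun U hU V hV hUV => ?_,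
    fun T hT => ⟨T.compl i, ⟨T.compl_mem_spanningSubcomplexes i, ?_⟩, T.compl_compl hT.1⟩⟩
  · change ((U.compl i).cells i).card = _
    rw [U.compl_cells_self, Finset.card_compl, hU.2]
    omega
  · rw [← U.compl_compl hU.1, ← V.compl_compl hV.1]
    exact congrArg (fun Y => Subcomplex.compl Y i) hUV
  · rw [T.compl_cells_self, Finset.card_compl, hT.2]
    omega

/-! ### Weights as lattice indices, and cocycles supported on U. -/

namespace Subcomplex

/-- A subcomplex containing all cells of dimension `< i` has the same generators as the ambient
complex in these dimensions. -/
def genEquiv {X : FiniteComplex.{u}} (T : X.Subcomplex) (i : ℕ)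
    (hT : ∀ n < i, T.cells n = Finset.univ) :
    ∀ n ≤ i + 1, T.toComplex.gen n ≃ X.gen n
  | 0, _ => Equiv.refl _
  | 1, _ => Equiv.refl _
  | n + 2, h => Equiv.subtypeUnivEquiv fun x => by
      rw [hT n (by omega)]
      exact Finset.mem_univ x

theorem toComplex_d {X : FiniteComplex.{u}} (T : X.Subcomplex) (i : ℕ)
    (hT : ∀ n < i, T.cells n = Finset.univ) :
    ∀ n (hn : n ≤ i), T.toComplex.d n =
      (X.d n).submatrix (T.genEquiv i hT n (by omega)) (T.genEquiv i hT (n + 1) (by omega))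
  | 0, _ => rfl
  | 1, _ => rfl
  | _ + 2, _ => rfl

theorem toComplex_d_succ {X : FiniteComplex.{u}} (T : X.Subcomplex) (i : ℕ)
    (hT : ∀ n < i, T.cells n = Finset.univ) :
    T.toComplex.d (i + 1) = (X.d (i + 1)).submatrix (T.genEquiv i hT (i + 1) le_rfl)
      (Subtype.val : {x // x ∈ T.cells i} → X.cell i) := by
  -- For `i = 0` the target of the boundary is the augmentation term, so the generators reduce only
  -- after a case split.
  cases i <;> rfl

theorem treeWeight_eq_index {X : FiniteComplex.{u}} {i : ℕ} {T : X.Subcomplex}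
    (hT : T ∈ X.spanningTrees i) :
    T.treeWeight i = ((X.coboundaries (i + 1)).toAddSubgroup.map
      (restrictCoords (n := X.gen (i + 2)) (T.cells i))).index := by
  have h1 : T.treeWeight i = Nat.card (matrixHomology (X.d i) ((X.d (i + 1)).submatrix id
      (Subtype.val : {x // x ∈ T.cells i} → X.cell i))) := by
    rw [treeWeight, redHomology, T.toComplex_d i hT.1.1 i le_rfl, T.toComplex_d_succ i hT.1.1]
    exact card_matrixHomology_submatrix (X.d i) ((X.d (i + 1)).submatrix id
      (Subtype.val : {x // x ∈ T.cells i} → X.cell i)) _ _ (Equiv.refl _)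
  rw [h1]
  exact card_matrixHomology_eq_index_map_restrictCoords (n := X.gen (i + 2)) (X.d_mul_d i)
    (T.cells i) hT.2

/-- The complement of U has no cells above dimension `i`, so the relative complex agrees with that
of X there, and its `i`-cells are those of U. -/
theorem dualCycletreeWeight_eq_relIndex {X : FiniteComplex.{u}} (U : X.Subcomplex) (i : ℕ) :
    U.dualCycletreeWeight i =
      (LinearMap.range ((X.d (i + 2)).transpose.submatrix id
        (Subtype.val : {x // x ∈ U.cells i} → X.cell i)).mulVecLin).toAddSubgroup.relIndex
        (X.cocycles (i + 2)).toAddSubgroup := by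
  have hU : ∀ n, i < n → ∀ x, x ∉ (U.compl i).cells n := fun n hn x => by
    rw [(U.compl_mem_spanningSubcomplexes i).2 n hn]
    exact Finset.notMem_empty x
  have hc : ∀ x, x ∉ (U.compl i).cells i ↔ x ∈ U.cells i := fun x => by
    rw [compl_cells_self, Finset.mem_compl, not_not]
  refine Eq.trans ?_ (card_matrixHomology _ _)
  exact card_matrixHomology_submatrix (X.d (i + 3)).transpose
    ((X.d (i + 2)).transpose.submatrix id (Subtype.val : {x // x ∈ U.cells i} → X.cell i))
    (Equiv.subtypeUnivEquiv (hU (i + 2) (by omega)))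
    (Equiv.subtypeUnivEquiv (hU (i + 1) (by omega)))
    (Equiv.subtypeEquivRight hc)

theorem gcd_cocyclePartVector {X : FiniteComplex.{u}} {i m : ℕ} (U : X.Subcomplex)
    (Z : Module.Basis (Fin m) ℤ (X.cocycles (i + 2)))
    (e : Fin (m + 1) ≃ {x : X.cell i // x ∈ U.cells i}) :
    Finset.univ.gcd (U.cocyclePartVector Z e) =
      Finset.univ.gcd (minorVector (X.coboundaryMatrix Z fun q => (e q).1)) := by
  refine gcd_univ_extend ?_ ?_
  · rintro _ ⟨x, rfl⟩
    by_cases hx : x ∈ U.cells i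
    · have h : U.cocyclePartVector Z e x =
          minorVector (X.coboundaryMatrix Z fun q => (e q).1) (e.symm ⟨x, hx⟩) := dif_pos hx
      exact Or.inl ⟨e.symm ⟨x, hx⟩, h.symm⟩
    · exact Or.inr (dif_neg hx)
  · rintro _ ⟨q, rfl⟩
    refine ⟨(e q).1, (dif_pos (e q).2).trans ?_⟩
    rw [Subtype.coe_eta, e.symm_apply_apply]

theorem dualCycletreeWeight_eq_gcd {X : FiniteComplex.{u}} {i m : ℕ} (U : X.Subcomplex)
    (Z : Module.Basis (Fin m) ℤ (X.cocycles (i + 2)))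
    (e : Fin (m + 1) ≃ {x : X.cell i // x ∈ U.cells i}) :
    U.dualCycletreeWeight i = (Finset.univ.gcd (U.cocyclePartVector Z e)).natAbs := by
  rw [gcd_cocyclePartVector, ← index_range_mulVecLin_eq_gcd, coboundaryMatrix,
    ← relIndex_span_range Z fun q => X.cellCoboundary (e q).1, dualCycletreeWeight_eq_relIndex,
    Matrix.range_mulVecLin]
  congr 3
  exact (EquivLike.range_comp (fun x : {x : X.cell i // x ∈ U.cells i} =>
    (X.cellCoboundary x.1 : X.gen (i + 3) → ℤ)) e).symm

theorem sum_smul_cellCoboundary {X : FiniteComplex.{u}} {i : ℕ} (v : X.cell i → ℤ) :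
    ((∑ x, v x • X.cellCoboundary x : X.cocycles (i + 2)) : X.gen (i + 3) → ℤ) =
      (X.d (i + 2)).transpose.mulVec v := by
  ext y
  simp only [AddSubmonoidClass.coe_finsetSum, SetLike.val_smul, Finset.sum_apply,
    Pi.smul_apply, smul_eq_mul]
  exact Finset.sum_congr rfl fun x _ => mul_comm _ _

/-- The cocycles supported on a dual cycletree of nonzero weight are the multiples of its primitive
cocycle part. -/
theorem ker_restrictCoords_inf_cocycles {X : FiniteComplex.{u}} {i m : ℕ} {U : X.Subcomplex}
    {T : Finset (X.cell i)} (hT : ∀ x, x ∈ U.cells i ↔ x ∉ T)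
    (Z : Module.Basis (Fin m) ℤ (X.cocycles (i + 2)))
    (e : Fin (m + 1) ≃ {x : X.cell i // x ∈ U.cells i})
    (hU : U.cocyclePartVector Z e ≠ 0) :
    (restrictCoords (n := X.gen (i + 2)) T).ker ⊓ (X.cocycles (i + 1)).toAddSubgroup =
      AddSubgroup.zmultiples (U.primitiveCocyclePart Z e : X.gen (i + 2) → ℤ) := by
  set A := X.coboundaryMatrix Z fun q => (e q).1 with hA
  have hA0 : minorVector A ≠ 0 := fun h => hU <| by
    ext x
    by_cases hx : x ∈ U.cells i
    · exact (dif_pos hx).trans (congrFun h _)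
    · exact dif_neg hx
  have hC : ∀ x (hx : x ∈ U.cells i), primitivePart (U.cocyclePartVector Z e) x =
      primitivePart (minorVector A) (e.symm ⟨x, hx⟩) := by
    intro x hx
    have h : U.cocyclePartVector Z e x = minorVector A (e.symm ⟨x, hx⟩) := dif_pos hx
    rw [primitivePart, primitivePart, h, gcd_cocyclePartVector]
  have hC0 : ∀ x, x ∉ U.cells i → primitivePart (U.cocyclePartVector Z e) x = 0 := by
    intro x hx
    have h : U.cocyclePartVector Z e x = 0 := dif_neg hx
    rw [primitivePart, h, Int.zero_ediv]
  apply le_antisymm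
  · rintro v ⟨hv, hvZ⟩
    have hv := mem_ker_restrictCoords.mp hv
    have hv0 : ∀ x, x ∉ U.cells i → v x = 0 := fun x hx => hv x (by simpa [hT] using hx)
    have hAv : A.mulVec (fun q => v (e q).1) = 0 := by
      -- A cocycle is a linear relation among coboundaries of cells; support in U turns it into a
      -- kernel vector of `A`.
      have h0 : ∑ x, v x • X.cellCoboundary x = 0 :=
        Subtype.ext ((sum_smul_cellCoboundary v).trans hvZ)
      rw [← Finset.sum_subset (Finset.subset_univ (U.cells i))
        fun x _ hx => by rw [hv0 x hx, zero_smul], ← Finset.sum_coe_sort (U.cells i),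
        ← e.sum_comp] at h0
      ext p
      have h1 := congrArg (fun z => Z.repr z p) h0
      simp only [map_sum, map_smul, Finsupp.coe_finsetSum, Finset.sum_apply, Finsupp.smul_apply,
        smul_eq_mul, map_zero, Finsupp.coe_zero, Pi.zero_apply] at h1
      rw [Pi.zero_apply, ← h1]
      change ∑ q, A p q * v (e q).1 = _
      exact Finset.sum_congr rfl fun q _ => mul_comm (A p q) _
    obtain ⟨c, hc⟩ := eq_smul_primitivePart_minorVector hA0 hAv
    refine ⟨c, ?_⟩
    ext x
    change c * primitivePart (U.cocyclePartVector Z e) x = v x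
    by_cases hx : x ∈ U.cells i
    · have h := congrFun hc (e.symm ⟨x, hx⟩)
      simp only [e.apply_symm_apply, Pi.smul_apply, smul_eq_mul] at h
      rw [hC x hx, h]
    · rw [hC0 x hx, hv0 x hx, mul_zero]
  · rw [AddSubgroup.zmultiples_le]
    exact ⟨mem_ker_restrictCoords.mpr fun x hx => hC0 x fun h => (hT x).mp h hx,
      (U.primitiveCocyclePart Z e).2⟩

end Subcomplex

/-! ### The cutting number and the final comparison. -/

theorem natAbs_cuttingNumber (X : FiniteComplex.{u}) {i k : ℕ}
    (Z : Module.Basis (Fin (k + 1)) ℤ (X.cocycles (i + 1)))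
    (B : Module.Basis (Fin k) ℤ (X.coboundaries (i + 1)))
    (z : X.cocycles (i + 1)) :
    (X.cuttingNumber Z B z).natAbs =
      ((X.coboundaries (i + 1)).toAddSubgroup ⊔
        AddSubgroup.zmultiples (z : X.gen (i + 2) → ℤ)).relIndex
        (X.cocycles (i + 1)).toAddSubgroup := by
  rw [cuttingNumber, ← index_range_mulVecLin, ← relIndex_span_range Z]
  congr 1
  have h1 : Submodule.span ℤ (Set.range fun j => (B j : X.gen (i + 2) → ℤ)) =
      X.coboundaries (i + 1) := by
    have h := congrArg (Submodule.map (X.coboundaries (i + 1)).subtype) B.span_eq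
    rw [Submodule.map_span, ← Set.range_comp, Submodule.map_subtype_top] at h
    exact h
  have h2 : (Set.range fun q => (((Fin.cons z fun j =>
      Submodule.inclusion (X.coboundaries_le_cocycles (i + 1)) (B j) :
      Fin (k + 1) → X.cocycles (i + 1)) q : X.cocycles (i + 1)) : X.gen (i + 2) → ℤ)) =
      insert (z : X.gen (i + 2) → ℤ) (Set.range fun j => (B j : X.gen (i + 2) → ℤ)) := by
    rw [← Fin.range_cons]
    congr 1
    ext q : 1
    refine Fin.cases ?_ (fun q => ?_) q <;> rfl
  rw [h2, Submodule.span_insert, h1, sup_comm, Submodule.sup_toAddSubgroup]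
  congr 1
  ext x
  exact Submodule.mem_span_singleton.trans AddSubgroup.mem_zmultiples_iff.symm

theorem cuttingNumber_smul (X : FiniteComplex.{u}) {i k : ℕ}
    (Z : Module.Basis (Fin (k + 1)) ℤ (X.cocycles (i + 1)))
    (B : Module.Basis (Fin k) ℤ (X.coboundaries (i + 1)))
    (c : ℤ) (z : X.cocycles (i + 1)) :
    X.cuttingNumber Z B (c • z) = c * X.cuttingNumber Z B z := by
  have h : ∀ z, X.cuttingNumber Z B z = Z.det (Fin.cons z fun j =>
      Submodule.inclusion (X.coboundaries_le_cocycles (i + 1)) (B j)) := fun z => rfl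
  rw [h, h, ← smul_eq_mul]
  have h1 := Z.det.map_update_smul (Fin.cons z fun j =>
      Submodule.inclusion (X.coboundaries_le_cocycles (i + 1)) (B j)) 0 c z
  rwa [Fin.update_cons_zero, Fin.update_cons_zero] at h1

/-- The order of `H^{i+1}(X, T)` times the cutting number of the primitive cocycle part equals the
order of `H̃_{i-1}(T)` times that of `H̃^{i+1}(X)`. -/
theorem dualCycletreeWeight_mul_cuttingNumber {X : FiniteComplex.{u}} {i m k : ℕ}
    {U T : X.Subcomplex} (hT : T ∈ X.spanningTrees i) (hUT : U = T.compl i)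
    (Z' : Module.Basis (Fin m) ℤ (X.cocycles (i + 2)))
    (e : Fin (m + 1) ≃ {x : X.cell i // x ∈ U.cells i})
    (Z : Module.Basis (Fin (k + 1)) ℤ (X.cocycles (i + 1)))
    (B : Module.Basis (Fin k) ℤ (X.coboundaries (i + 1))) :
    U.dualCycletreeWeight i * (X.cuttingNumber Z B (U.primitiveCocyclePart Z' e)).natAbs =
      T.treeWeight i * Nat.card (X.redCohomology (i + 2)) := by
  have hmem : ∀ x, x ∈ U.cells i ↔ x ∉ T.cells i := fun x => by
    rw [hUT, Subcomplex.compl_cells_self, Finset.mem_compl]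
  set π := restrictCoords (n := X.gen (i + 2)) (T.cells i)
  set p := ((X.cocycles (i + 1)).toAddSubgroup.map π).index
  have hwU : U.dualCycletreeWeight i = p * Nat.card (X.redCohomology (i + 2)) := by
    have h1 : U.dualCycletreeWeight i =
        (π.ker.map (X.d (i + 2)).transpose.mulVecLin.toAddMonoidHom).relIndex
          (X.cocycles (i + 2)).toAddSubgroup :=
      (U.dualCycletreeWeight_eq_relIndex i).trans
        (congrArg (fun H => AddSubgroup.relIndex H (X.cocycles (i + 2)).toAddSubgroup)
          (range_submatrix_mulVecLin (n := X.gen (i + 2)) (X.d (i + 2)).transpose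
            (U.cells i) (T.cells i) hmem))
    rw [h1]
    exact relIndex_map_ker (restrictCoords_surjective _) _ (X.coboundaries_le_cocycles (i + 2))
  have hwT : T.treeWeight i = ((X.coboundaries (i + 1)).toAddSubgroup ⊔
      π.ker ⊓ (X.cocycles (i + 1)).toAddSubgroup).relIndex
        (X.cocycles (i + 1)).toAddSubgroup * p :=
    (Subcomplex.treeWeight_eq_index hT).trans
      (index_map_of_le π (X.coboundaries_le_cocycles (i + 1)))
  -- If C_U = 0, its primitive part no longer generates ker π ∩ Z^i, but p·h = wt(U) = 0 makes both
  -- sides vanish.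
  by_cases hC : U.cocyclePartVector Z' e = 0
  · have h0 : U.dualCycletreeWeight i = 0 := by
      rw [U.dualCycletreeWeight_eq_gcd Z' e, hC, Int.natAbs_eq_zero]
      exact Finset.gcd_eq_zero_iff.mpr fun _ _ => rfl
    rw [hwT, mul_assoc, ← hwU, h0, zero_mul, mul_zero]
  · rw [natAbs_cuttingNumber, ← Subcomplex.ker_restrictCoords_inf_cocycles hmem Z' e hC, hwT, hwU]
    ring

end FiniteComplex

theorem mainTheorem6 (X : FiniteComplex.{u}) (i : ℕ) (hX : X.Unicycle i) :
    Set.BijOn (fun U : X.Subcomplex => U.compl i) (X.dualCycletrees i) (X.spanningTrees i) ∧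
    ∀ U ∈ X.dualCycletrees i, ∀ T ∈ X.spanningTrees i, U = T.compl i →
      ∀ (m : ℕ) (Z' : Module.Basis (Fin m) ℤ (X.cocycles (i + 2)))
        (e : Fin (m + 1) ≃ {x : X.cell i // x ∈ U.cells i})
        (k : ℕ) (Z : Module.Basis (Fin (k + 1)) ℤ (X.cocycles (i + 1)))
        (B : Module.Basis (Fin k) ℤ (X.coboundaries (i + 1))),
        |X.cuttingNumber Z B (U.cocyclePart Z' e)| =
            (U.dualCycletreeWeight i : ℤ) * |X.cuttingNumber Z B (U.primitiveCocyclePart Z' e)| ∧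
        (U.dualCycletreeWeight i : ℤ) * |X.cuttingNumber Z B (U.primitiveCocyclePart Z' e)| =
            (T.treeWeight i : ℤ) * (Nat.card (X.redCohomology (i + 2)) : ℤ) ∧
        (X.cuttingNumber Z B (U.cocyclePart Z' e) = 0 ↔ T.treeWeight i = 0) := by
  refine ⟨hX.bijOn_compl, fun U _ T hT hUT m Z' e k Z B => ?_⟩
  have h1 : |X.cuttingNumber Z B (U.cocyclePart Z' e)| =
      (U.dualCycletreeWeight i : ℤ) * |X.cuttingNumber Z B (U.primitiveCocyclePart Z' e)| := by
    have h : U.cocyclePart Z' e = Finset.univ.gcd (U.cocyclePartVector Z' e) •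
        U.primitiveCocyclePart Z' e :=
      Subtype.ext (gcd_smul_primitivePart (U.cocyclePartVector Z' e)).symm
    rw [h, X.cuttingNumber_smul, abs_mul, U.dualCycletreeWeight_eq_gcd Z' e, Int.natCast_natAbs]
  have h2 : (U.dualCycletreeWeight i : ℤ) *
      |X.cuttingNumber Z B (U.primitiveCocyclePart Z' e)| =
        (T.treeWeight i : ℤ) * (Nat.card (X.redCohomology (i + 2)) : ℤ) := by
    rw [← Int.natCast_natAbs]
    exact_mod_cast FiniteComplex.dualCycletreeWeight_mul_cuttingNumber hT hUT Z' e Z B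
  refine ⟨h1, h2, ?_⟩
  -- Finiteness makes the order of H̃^{i+1}(X) positive, so that factor can be cancelled.
  have := hX.finite_redCohomology
  rw [← abs_eq_zero, h1, h2, ← Nat.cast_mul, Nat.cast_eq_zero, mul_eq_zero, or_iff_left]
  exact Nat.card_pos.ne'
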